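/- Let $H$ be a compact Hausdorff space with Borel $\sigma$-algebra $\beta(H)$, $C(H)$ the Banach space of continuous real functions on $H$, $Y$ a real Banach space, and $T:C(H)\to Y$ a bounded linear operator. Regard $Y$ as a subspace of $Y^{**}$, and let $m:\beta(H)\to Y^{**}$ be the representing measure of $T$: the finitely additive set function that is weakly regular (for each $y^*\in Y^*$ the scalar set function $A\mapsto\langle m(A),y^*\rangle$ is a regular countably additive measure) and satisfies $T(f)=\int f\,dm$ for all $f\in C(H)$, where the integral is the limit of the integrals of simple functions converging uniformly to $f$. Let $\mu:\beta(H)\to[0,\infty)$ be a countably additive measure with $m\ll\mu$, i.e. $\|m(A)\|\to0$ as $\mu(A)\to0$. For a finite partition $\pi$ of $H$ into Borel sets put, with the convention $\tfrac00=0$, $$m_\pi(B)=\sum_{A\in\pi}\frac{\mu(A\cap B)}{\mu(A)}\,m(A)\quad(B\in\beta(H)),\qquad T_\pi(f)=\sum_{A\in\pi}\frac{\int_A f\,d\mu}{\mu(A)}\,m(A)\quad(f\in C(H)),$$ and consider the nets $(m_\pi)$ and $(T_\pi)$ directed by refinement of partitions. The semivariation norm of a finitely additive $F:\beta(H)\to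 Y^{**}$ is $$\widetilde F(H)=\sup\Big\|\sum_i c_iF(A_i)\Big\|,$$ the supremum being over all finite Borel partitions $(A_i)$ of $H$ and all real $c_i$ with $|c_i|\le1$. Then the following are equivalent: (1) $m_\pi\to m$ in semivariation norm; (2) $m$ has relatively norm compact range; (3) $T$ is compact. If, in addition, $\mu$ is regular, then (1)--(3) are equivalent to (4) $T_\pi\to T$ in operator norm. -/

import Mathlib

open MeasureTheory Filter Topology
open scoped ENNReal

noncomputable section

namespace VecMeas

/-- The finite partitions of `Ω` into measurable sets. They are ordered by refinement, `π ≤ ρ`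
meaning that `π` refines `ρ`, so that limits along the net of partitions directed by refinement are
limits along `atBot`. -/
abbrev Partition (Ω : Type*) [MeasurableSpace Ω] : Type _ :=
  Finpartition (⊤ : {s : Set Ω // MeasurableSet s})

/-- A finitely additive set function defined on the measurable sets, with values in `E`.
(The values of the underlying function at non-measurable sets are irrelevant.) -/
abbrev FinAddMeasure (Ω : Type*) [MeasurableSpace Ω] (E : Type*) [NormedAddCommGroup E] :
    Type _ :=
  AddContent E {s : Set Ω | MeasurableSet s}

section general

variable {Ω : Type*} [MeasurableSpace Ω] {E : Type*} [NormedAddCommGroup E] [NormedSpace ℝ E]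

/-- The semivariation of a set function `F` on a measurable set `A`: the supremum of
`‖∑ cᵢ F(Aᵢ)‖` over all finite measurable partitions `(Aᵢ)` of `A` and scalars `|cᵢ| ≤ 1`. -/
def semivariation (F : Set Ω → E) (A : {s : Set Ω // MeasurableSet s}) : ℝ≥0∞ :=
  ⨆ (P : Finpartition A) (c : {s : Set Ω // MeasurableSet s} → ℝ) (_ : ∀ B, |c B| ≤ 1),
    ‖∑ B ∈ P.parts, c B • F B‖ₑ

/-- `m ≪ μ`: `m(A) → 0` in norm as `μ(A) → 0`. -/
def AbsCont (m : FinAddMeasure Ω E) (μ : Measure Ω) : Prop :=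
  ∀ ε > (0 : ℝ), ∃ δ > (0 : ℝ), ∀ A, MeasurableSet A → μ.real A < δ → ‖m A‖ < ε

/-- The integral of a real simple function against a finitely additive vector measure. -/
def simpleIntegral (m : FinAddMeasure Ω E) (s : SimpleFunc Ω ℝ) : E :=
  ∑ r ∈ s.range, r • m (s ⁻¹' {r})

/-- `∫ f dm = I`, for a uniform limit `f` of simple functions: the integrals of simple functions
converge to `I` as the simple functions converge uniformly to `f`. -/
def HasIntegral (m : FinAddMeasure Ω E) (f : Ω → ℝ) (I : E) : Prop :=
  ∀ ε > (0 : ℝ), ∃ δ > (0 : ℝ), ∀ s : SimpleFunc Ω ℝ,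
    (∀ x, |s x - f x| ≤ δ) → ‖simpleIntegral m s - I‖ ≤ ε

/-- The conditional expectation `m_π` of `m` by `π` and `μ`:
`m_π(B) = ∑_{A ∈ π} (μ(A ∩ B) / μ(A)) m(A)`, with `0 / 0 = 0`. -/
def condMeasure (μ : Measure Ω) (m : FinAddMeasure Ω E) (π : Partition Ω) (B : Set Ω) : E :=
  ∑ A ∈ π.parts, (μ.real ((A : Set Ω) ∩ B) / μ.real (A : Set Ω)) • m (A : Set Ω)

/-- `m` has relatively norm compact range. -/
def HasRelCompactRange (m : FinAddMeasure Ω E) : Prop :=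
  IsCompact (closure {y : E | ∃ A : Set Ω, MeasurableSet A ∧ m A = y})

end general

section bidual

variable (Y : Type*) [NormedAddCommGroup Y] [NormedSpace ℝ Y]

/-- The bidual `Y**` of a real normed space `Y`, with its operator norm. -/
def Bidual : Type _ := StrongDual ℝ (StrongDual ℝ Y)

instance : NormedAddCommGroup (Bidual Y) :=
  inferInstanceAs (NormedAddCommGroup (StrongDual ℝ (StrongDual ℝ Y)))

instance : NormedSpace ℝ (Bidual Y) :=
  inferInstanceAs (NormedSpace ℝ (StrongDual ℝ (StrongDual ℝ Y)))

/-- The canonical isometric embedding of `Y` in `Y**`. -/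
def toBidual : Y →ₗᵢ[ℝ] Bidual Y :=
  (NormedSpace.inclusionInDoubleDualLi ℝ : Y →ₗᵢ[ℝ] StrongDual ℝ (StrongDual ℝ Y))

variable {Y}

/-- The value `⟨z, φ⟩` of `z ∈ Y**` at `φ ∈ Y*`. -/
def Bidual.pair (z : Bidual Y) (φ : StrongDual ℝ Y) : ℝ :=
  (show StrongDual ℝ (StrongDual ℝ Y) from z) φ

end bidual

section compactSpace

variable {H : Type*} [TopologicalSpace H] [CompactSpace H] [MeasurableSpace H] [BorelSpace H]
  {E : Type*} [NormedAddCommGroup E] [NormedSpace ℝ E]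
  {Y : Type*} [NormedAddCommGroup Y] [NormedSpace ℝ Y]

/-- `m : β(H) → Y**` is weakly regular: for every `y* ∈ Y*`, the scalar set function
`A ↦ ⟨m(A), y*⟩` is a regular countably additive measure. -/
def WeaklyRegular (m : FinAddMeasure H (Bidual Y)) : Prop :=
  ∀ φ : StrongDual ℝ Y, ∃ ν : SignedMeasure H, ν.variation.Regular ∧
    ∀ A, MeasurableSet A → ν A = (m A).pair φ

/-- `m ↔ T`: `m` is the weakly regular `Y**`-valued measure representing the operator
`T : C(H) → Y`, that is, `T f = ∫ f dm` for all `f`, where `Y` is embedded in `Y**`. -/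
def Represents (m : FinAddMeasure H (Bidual Y)) (T : C(H, ℝ) →L[ℝ] Y) : Prop :=
  WeaklyRegular m ∧
    ∀ f : C(H, ℝ), HasIntegral m f (toBidual Y (T f))

/-- The bounded linear functional `f ↦ ∫_A f dμ` on `C(H)`. -/
def setIntegralFunctional (μ : Measure H) [IsFiniteMeasure μ] (A : Set H) : C(H, ℝ) →L[ℝ] ℝ :=
  have hint : ∀ f : C(H, ℝ), Integrable f (μ.restrict A) := fun f =>
    Integrable.of_bound f.continuous.aestronglyMeasurable ‖f‖ (ae_of_all _ f.norm_coe_le_norm)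
  LinearMap.mkContinuous
    { toFun := fun f => ∫ x in A, f x ∂μ
      map_add' := fun f g => integral_add (hint f) (hint g)
      map_smul' := fun c f => integral_const_mul c f }
    (μ.real A) (fun f => by
      have h := norm_integral_le_of_norm_le_const (μ := μ.restrict A)
        (ae_of_all _ f.norm_coe_le_norm)
      simpa [mul_comm] using h)

/-- The conditional expectation operator `T_π` of the operator represented by `m`:
`T_π(f) = ∑_{A ∈ π} ((∫_A f dμ) / μ(A)) m(A)`, with `0 / 0 = 0`. -/
def condOperator (μ : Measure H) [IsFiniteMeasure μ] (m : FinAddMeasure H E) (π : Partition H) :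
    C(H, ℝ) →L[ℝ] E :=
  ∑ A ∈ π.parts,
    ((μ.real (A : Set H))⁻¹ • setIntegralFunctional μ (A : Set H)).smulRight (m (A : Set H))

theorem condOperator_apply (μ : Measure H) [IsFiniteMeasure μ] (m : FinAddMeasure H E)
    (π : Partition H) (f : C(H, ℝ)) :
    condOperator μ m π f =
      ∑ A ∈ π.parts, ((∫ x in (A : Set H), f x ∂μ) / μ.real (A : Set H)) • m (A : Set H) := by
  simp [condOperator, setIntegralFunctional, div_eq_inv_mul]

end compactSpace

end VecMeas

end

namespace VecMeas

open scoped Pointwise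

/-! Everything reduces to uniform convergence on sets, because the semivariation lies between `sup
‖F(A)‖` and `2 * sup ‖F(A)‖`.

(2) implies (1): by Mazur's theorem the range of `m` lies in a compact convex `K`. Each `m_π(B)` is
a combination, with coefficients in `[0, 1]`, of values of `m` on disjoint sets, so it lies in `K`
too. On the compact set `K - K` the norm is controlled, up to `ε`, by finitely many functionals `φ`.
For each of them `φ ∘ m` has an `L¹(μ)` density, and the conditional expectations of that density
converge (`AbsCont.eventually_condMeasure_sub_le`). (1) implies (2): `m` is a uniform limit of the
`m_π`, whose ranges lie in continuous images of cubes.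

(2) implies (3): `T` maps the unit ball into `K - K` (`HasIntegral.mem_sub`). (3) implies (2): by
regularity and Urysohn's lemma each `m(A)` is a weak* limit of values of `T` on the unit ball
(`exists_norm_le_one_abs_pair_sub_le`). These values lie in a norm compact set, which is weak*
closed and so contains `m(A)`.

(1) implies (4) by `norm_condOperator_sub_le`, and (4) implies (3) because each `T_π` has finite
rank. -/

/-- The pointwise difference of a compact set with itself is compact. -/
theorem isCompact_sub_self {E : Type*} [NormedAddCommGroup E] {K : Set E} (hK : IsCompact K) :
    IsCompact (K - K) := by
  rw [sub_eq_add_neg]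
  exact hK.add hK.neg

theorem closedBall_sub_closedBall_subset {E : Type*} [NormedAddCommGroup E] (M : ℝ) :
    Metric.closedBall (0 : E) M - Metric.closedBall 0 M ⊆ Metric.closedBall 0 (2 * M) := by
  rintro _ ⟨a, ha, b, hb, rfl⟩
  rw [mem_closedBall_zero_iff] at *
  have := norm_sub_le a b
  simp only at *
  linarith

/-! ### Convex combinations and norms on compact sets -/

section convex

variable {E : Type*} [NormedAddCommGroup E] [NormedSpace ℝ E] {ι : Type*}

/-- A closed convex set containing all subset sums of a finite family contains every combination
of the family with coefficients in `[0, 1]`. -/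
theorem sum_smul_mem_of_subset_sum_mem {K : Set E} (hK : Convex ℝ K) (hKc : IsClosed K)
    (S : Finset ι) (x : ι → E) (h : ∀ S' ⊆ S, ∑ i ∈ S', x i ∈ K) (c : ι → ℝ)
    (hc₀ : ∀ i ∈ S, 0 ≤ c i) (hc₁ : ∀ i ∈ S, c i ≤ 1) : ∑ i ∈ S, c i • x i ∈ K := by
  classical
  by_contra hx
  obtain ⟨f, u, hu, hux⟩ := geometric_hahn_banach_closed_point hK hKc hx
  -- Keeping exactly the terms with `f (x i) ≥ 0` maximises `f` over all coefficients in `[0, 1]`.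
  have h1 := hu _ (h (S.filter fun i => 0 ≤ f (x i)) (Finset.filter_subset _ _))
  rw [map_sum] at h1 hux
  have h2 : ∑ i ∈ S, f (c i • x i) ≤ ∑ i ∈ S.filter (fun i => 0 ≤ f (x i)), f (x i) := by
    rw [Finset.sum_filter]
    refine Finset.sum_le_sum fun i hi => ?_
    rw [map_smul, smul_eq_mul]
    split_ifs with hf
    · exact mul_le_of_le_one_left hf (hc₁ i hi)
    · exact mul_nonpos_of_nonneg_of_nonpos (hc₀ i hi) (not_le.mp hf).le
  linarith

/-- The positive and negative parts of the coefficients both lie in `[0, 1]`. -/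
theorem sum_smul_mem_sub_of_subset_sum_mem {K : Set E} (hK : Convex ℝ K) (hKc : IsClosed K)
    (S : Finset ι) (x : ι → E) (h : ∀ S' ⊆ S, ∑ i ∈ S', x i ∈ K) (c : ι → ℝ)
    (hc : ∀ i ∈ S, |c i| ≤ 1) : ∑ i ∈ S, c i • x i ∈ K - K := by
  have hsplit : ∑ i ∈ S, c i • x i = ∑ i ∈ S, (c i)⁺ • x i - ∑ i ∈ S, (c i)⁻ • x i := by
    rw [← Finset.sum_sub_distrib]
    refine Finset.sum_congr rfl fun i _ => ?_
    rw [← sub_smul, posPart_sub_negPart]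
  rw [hsplit]
  refine Set.sub_mem_sub
    (sum_smul_mem_of_subset_sum_mem hK hKc S x h _ (fun i _ => posPart_nonneg _) fun i hi => ?_)
    (sum_smul_mem_of_subset_sum_mem hK hKc S x h _ (fun i _ => negPart_nonneg _) fun i hi => ?_)
  · exact sup_le ((le_abs_self _).trans (hc i hi)) zero_le_one
  · exact sup_le ((neg_le_abs _).trans (hc i hi)) zero_le_one

/-- On a compact set the norm is, up to `ε`, the supremum of finitely many functionals of norm at
most one. -/
theorem exists_finset_functional_norm_le {D : Set E} (hD : IsCompact D) {ε : ℝ} (hε : 0 < ε) :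
    ∃ t : Finset (StrongDual ℝ E), ∀ x ∈ D, (∀ φ ∈ t, |φ x| ≤ ε) → ‖x‖ ≤ 3 * ε := by
  classical
  -- Take norming functionals at the centres `y` of an `ε`-net: `‖y‖ = φ y y ≤ |φ y x| + ε ≤ 2ε`,
  -- whence `‖x‖ ≤ 3ε`.
  obtain ⟨t, ht, hcov⟩ := Metric.totallyBounded_iff.mp hD.totallyBounded ε hε
  choose φ hφ1 hφ2 using fun x : E => exists_dual_vector'' ℝ x
  refine ⟨ht.toFinset.image φ, fun x hx hsmall => ?_⟩
  obtain ⟨y, hy, hxy⟩ := Set.mem_iUnion₂.mp (hcov hx)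
  rw [Metric.mem_ball, dist_eq_norm] at hxy
  have h1 : |φ y x| ≤ ε := hsmall _ (Finset.mem_image_of_mem _ (ht.mem_toFinset.mpr hy))
  have h2 : |φ y (x - y)| ≤ ‖x - y‖ := by
    simpa using (φ y).le_of_opNorm_le (hφ1 y) (x - y)
  have h3 : φ y y = ‖y‖ := by simpa using hφ2 y
  rw [map_sub, h3] at h2
  have h4 : ‖x‖ ≤ ‖x - y‖ + ‖y‖ := by simpa using norm_add_le (x - y) y
  have := abs_le.mp h1
  have := abs_le.mp h2
  linarith

end convex

/-! ### Finitely additive measures, semivariation and conditional expectations -/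

section contents

variable {Ω : Type*} [MeasurableSpace Ω] {E : Type*} [NormedAddCommGroup E] [NormedSpace ℝ E]

theorem isSetRing_measurableSet : IsSetRing {s : Set Ω | MeasurableSet s} where
  empty_mem := MeasurableSet.empty
  union_mem _ _ hs ht := MeasurableSet.union hs ht
  sdiff_mem _ _ hs ht := MeasurableSet.diff hs ht

theorem measure_biUnion_eq_sum {E : Type*} [NormedAddCommGroup E] (m : FinAddMeasure Ω E)
    {ι : Type*} (S : Finset ι) (A : ι → Set Ω) (hA : ∀ i ∈ S, MeasurableSet (A i))
    (hd : (S : Set ι).PairwiseDisjoint A) :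
    m (⋃ i ∈ S, A i) = ∑ i ∈ S, m (A i) :=
  addContent_biUnion hA hd (Finset.measurableSet_biUnion S hA)

/-- By additivity a subset sum is itself a value of `m`, at the union. -/
theorem subset_sum_mem {E : Type*} [NormedAddCommGroup E] {K : Set E} (m : FinAddMeasure Ω E)
    (hm : ∀ A, MeasurableSet A → m A ∈ K) {ι : Type*} (S : Finset ι) (A : ι → Set Ω)
    (hA : ∀ i ∈ S, MeasurableSet (A i)) (hd : (S : Set ι).PairwiseDisjoint A) (S' : Finset ι)
    (hS : S' ⊆ S) : ∑ i ∈ S', m (A i) ∈ K := by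
  have hA' : ∀ i ∈ S', MeasurableSet (A i) := fun i hi => hA i (hS hi)
  rw [← measure_biUnion_eq_sum m S' A hA' (hd.subset (Finset.coe_subset.mpr hS))]
  exact hm _ (Finset.measurableSet_biUnion S' hA')

section combinations

variable {K : Set E} (hK : Convex ℝ K) (hKc : IsClosed K) (m : FinAddMeasure Ω E)
  (hm : ∀ A, MeasurableSet A → m A ∈ K) {ι : Type*} (S : Finset ι) (A : ι → Set Ω)
  (hA : ∀ i ∈ S, MeasurableSet (A i)) (hd : (S : Set ι).PairwiseDisjoint A) (c : ι → ℝ)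

include hK hKc hm hA hd

theorem sum_smul_measure_mem (hc₀ : ∀ i ∈ S, 0 ≤ c i) (hc₁ : ∀ i ∈ S, c i ≤ 1) :
    ∑ i ∈ S, c i • m (A i) ∈ K :=
  sum_smul_mem_of_subset_sum_mem hK hKc S _ (subset_sum_mem m hm S A hA hd) c hc₀ hc₁

theorem sum_smul_measure_mem_sub (hc : ∀ i ∈ S, |c i| ≤ 1) :
    ∑ i ∈ S, c i • m (A i) ∈ K - K :=
  sum_smul_mem_sub_of_subset_sum_mem hK hKc S _ (subset_sum_mem m hm S A hA hd) c hc

end combinations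

theorem pairwiseDisjoint_parts {A : {s : Set Ω // MeasurableSet s}} (P : Finpartition A) :
    (P.parts : Set {s : Set Ω // MeasurableSet s}).PairwiseDisjoint fun B => (B : Set Ω) := by
  intro B hB C hC hBC
  exact (disjoint_subtype_iff (fun _ _ hs ht => hs.inter ht) MeasurableSet.empty).1
    (P.disjoint hB hC hBC)

theorem sup_parts_coe (S : Finset {s : Set Ω // MeasurableSet s}) :
    ((S.sup id : {s : Set Ω // MeasurableSet s}) : Set Ω) = ⋃ B ∈ S, (B : Set Ω) := by
  classical
  induction S using Finset.induction with
  | empty => simp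
  | insert B S _ ih =>
    rw [Finset.sup_insert, Finset.set_biUnion_insert, ← ih]
    rfl

theorem iUnion_parts (P : Partition Ω) : ⋃ B ∈ P.parts, (B : Set Ω) = Set.univ := by
  rw [← sup_parts_coe, P.sup_parts]
  rfl

theorem pairwiseDisjoint_fibers (s : SimpleFunc Ω ℝ) (S : Set ℝ) :
    S.PairwiseDisjoint fun r => s ⁻¹' {r} := by
  intro a _ b _ hab
  exact Disjoint.preimage _ (Set.disjoint_singleton.mpr hab)

theorem simpleIntegral_mem_sub {K : Set E} (hK : Convex ℝ K) (hKc : IsClosed K)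
    (m : FinAddMeasure Ω E) (hm : ∀ A, MeasurableSet A → m A ∈ K) (s : SimpleFunc Ω ℝ)
    (hs : ∀ x, |s x| ≤ 1) : simpleIntegral m s ∈ K - K := by
  refine sum_smul_measure_mem_sub hK hKc m hm s.range (fun r => s ⁻¹' {r})
    (fun r _ => s.measurableSet_fiber r) (pairwiseDisjoint_fibers s _) id fun r hr => ?_
  obtain ⟨x, rfl⟩ := SimpleFunc.mem_range.mp hr
  exact hs x

theorem norm_simpleIntegral_le (m : FinAddMeasure Ω E) {M : ℝ}
    (hm : ∀ A, MeasurableSet A → ‖m A‖ ≤ M) (s : SimpleFunc Ω ℝ) (hs : ∀ x, |s x| ≤ 1) :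
    ‖simpleIntegral m s‖ ≤ 2 * M := by
  rw [← mem_closedBall_zero_iff]
  exact closedBall_sub_closedBall_subset M <| simpleIntegral_mem_sub (convex_closedBall 0 M)
    Metric.isClosed_closedBall m (fun A hA => mem_closedBall_zero_iff.mpr (hm A hA)) s hs

/-- Apply the `K - K` lemma to the ball of radius `M`; this is the source of the factor 2. -/
theorem semivariation_le (m : FinAddMeasure Ω E) {M : ℝ}
    (hm : ∀ A, MeasurableSet A → ‖m A‖ ≤ M) (A : {s : Set Ω // MeasurableSet s}) :
    semivariation m A ≤ ENNReal.ofReal (2 * M) := by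
  refine iSup_le fun P => iSup_le fun c => iSup_le fun hc => ?_
  rw [← ofReal_norm]
  refine ENNReal.ofReal_le_ofReal ?_
  rw [← mem_closedBall_zero_iff]
  exact closedBall_sub_closedBall_subset M <| sum_smul_measure_mem_sub (convex_closedBall 0 M)
    Metric.isClosed_closedBall m (fun A hA => mem_closedBall_zero_iff.mpr (hm A hA)) P.parts
    (fun B => (B : Set Ω)) (fun B _ => B.2) (pairwiseDisjoint_parts P) c fun B _ => hc B

/-- The partition of the space into the fibers of a simple function. -/
noncomputable def fiberPartition (s : SimpleFunc Ω ℝ) : Partition Ω :=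
  open scoped Classical in
  Finpartition.ofErase (s.range.image fun r => ⟨s ⁻¹' {r}, s.measurableSet_fiber r⟩)
    (by
      rw [Finset.supIndep_iff_pairwiseDisjoint]
      intro A hA B hB hAB
      obtain ⟨a, -, rfl⟩ := Finset.mem_image.mp (Finset.mem_coe.mp hA)
      obtain ⟨b, -, rfl⟩ := Finset.mem_image.mp (Finset.mem_coe.mp hB)
      refine (disjoint_subtype_iff (fun _ _ hs ht => hs.inter ht) MeasurableSet.empty).2 ?_
      refine pairwiseDisjoint_fibers s Set.univ trivial trivial fun hab => hAB ?_
      rw [hab])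
    (by
      refine Subtype.ext ?_
      rw [sup_parts_coe]
      refine Set.eq_univ_of_forall fun x => ?_
      simp)

theorem exists_eq_of_mem_fiberPartition (s : SimpleFunc Ω ℝ) {A : {s : Set Ω // MeasurableSet s}}
    (hA : A ∈ (fiberPartition s).parts) : ∃ r, (A : Set Ω) = s ⁻¹' {r} := by
  classical
  rw [fiberPartition, Finpartition.ofErase_parts, Finset.mem_erase, Finset.mem_image] at hA
  obtain ⟨-, r, -, rfl⟩ := hA
  exact ⟨r, rfl⟩

theorem exists_eqOn_of_le_fiberPartition (s : SimpleFunc Ω ℝ) {π : Partition Ω}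
    (h : π ≤ fiberPartition s) {A : {s : Set Ω // MeasurableSet s}} (hA : A ∈ π.parts) :
    ∃ r, ∀ x ∈ (A : Set Ω), s x = r := by
  obtain ⟨B, hB, hAB⟩ := h hA
  obtain ⟨r, hr⟩ := exists_eq_of_mem_fiberPartition s hB
  refine ⟨r, fun x hx => ?_⟩
  have : x ∈ (B : Set Ω) := hAB hx
  rw [hr] at this
  exact this

theorem enorm_le_semivariation (m : FinAddMeasure Ω E) {A : Set Ω} (hA : MeasurableSet A) :
    ‖m A‖ₑ ≤ semivariation m ⊤ := by
  classical
  -- The fibers of the indicator of `A` give the partition into `A` and its complement, with no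
  -- separate treatment of an empty piece.
  set P := fiberPartition (SimpleFunc.piecewise A hA (SimpleFunc.const Ω (1 : ℝ))
    (SimpleFunc.const Ω 0))
  have hP : ∀ B ∈ P.parts, (B : Set Ω) ⊆ A ∨ (B : Set Ω) ∩ A = ∅ := by
    intro B hB
    obtain ⟨r, hr⟩ := exists_eqOn_of_le_fiberPartition _ le_rfl hB
    by_cases h : ((B : Set Ω) ∩ A).Nonempty
    · left
      obtain ⟨y, hyB, hyA⟩ := h
      intro x hx
      have h1 := hr y hyB
      have h2 := hr x hx
      by_contra hxA
      simp [SimpleFunc.piecewise_apply, hyA] at h1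
      simp [SimpleFunc.piecewise_apply, hxA] at h2
      linarith
    · exact Or.inr (Set.not_nonempty_iff_eq_empty.mp h)
  have hsum : m A = ∑ B ∈ P.parts, (if (B : Set Ω) ⊆ A then (1 : ℝ) else 0) • m B := by
    have h1 : A = ⋃ B ∈ P.parts, ((B : Set Ω) ∩ A) := by
      rw [← Set.iUnion₂_inter, iUnion_parts, Set.univ_inter]
    conv_lhs => rw [h1]
    rw [measure_biUnion_eq_sum m _ _ (fun B _ => B.2.inter hA)
      ((pairwiseDisjoint_parts P).mono fun B => Set.inter_subset_left)]
    refine Finset.sum_congr rfl fun B hB => ?_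
    split_ifs with h
    · rw [Set.inter_eq_left.mpr h, one_smul]
    · rw [(hP B hB).resolve_left h, addContent_empty, zero_smul]
  rw [hsum]
  refine le_iSup_of_le P (le_iSup_of_le _ (le_iSup_of_le ?_ le_rfl))
  intro B
  split_ifs <;> simp

/-- The composition of a finitely additive set function with a bounded operator. -/
def compMeasure {G : Type*} [NormedAddCommGroup G] [NormedSpace ℝ G] (φ : E →L[ℝ] G)
    (m : FinAddMeasure Ω E) : FinAddMeasure Ω G :=
  isSetRing_measurableSet.addContent_of_union (fun A => φ (m A)) (by simp) fun hs ht hd => by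
    rw [addContent_union isSetRing_measurableSet hs ht hd, map_add]

@[simp]
theorem compMeasure_apply {G : Type*} [NormedAddCommGroup G] [NormedSpace ℝ G] (φ : E →L[ℝ] G)
    (m : FinAddMeasure Ω E) (A : Set Ω) : compMeasure φ m A = φ (m A) := rfl

theorem map_condMeasure {G : Type*} [NormedAddCommGroup G] [NormedSpace ℝ G] (μ : Measure Ω)
    (m : FinAddMeasure Ω E) (π : Partition Ω) (φ : E →L[ℝ] G) (B : Set Ω) :
    φ (condMeasure μ m π B) = condMeasure μ (compMeasure φ m) π B := by
  simp [condMeasure, map_sum]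

variable (μ : Measure Ω) [IsFiniteMeasure μ] (m : FinAddMeasure Ω E) (π : Partition Ω)

theorem AbsCont.comp {μ : Measure Ω} {m : FinAddMeasure Ω E} (h : AbsCont m μ)
    (φ : StrongDual ℝ E) : AbsCont (compMeasure φ m) μ := by
  intro ε hε
  obtain ⟨δ, hδ, hm⟩ := h (ε / (‖φ‖ + 1)) (by positivity)
  refine ⟨δ, hδ, fun A hA hμA => ?_⟩
  have h1 := hm A hA hμA
  rw [lt_div_iff₀ (by positivity)] at h1
  calc ‖compMeasure φ m A‖ ≤ ‖φ‖ * ‖m A‖ := φ.le_opNorm _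
    _ ≤ ‖m A‖ * (‖φ‖ + 1) := by nlinarith [norm_nonneg (m A)]
    _ < ε := h1

theorem measureReal_inter_div_le_one (A B : Set Ω) : μ.real (A ∩ B) / μ.real A ≤ 1 :=
  div_le_one_of_le₀ (measureReal_mono Set.inter_subset_left) measureReal_nonneg

/-- The weights `μ(A ∩ B) / μ(A)` lie in `[0, 1]`, null cells included, so one `K` serves every `π`.
-/
theorem condMeasure_mem {K : Set E} (hK : Convex ℝ K) (hKc : IsClosed K)
    (hm : ∀ A, MeasurableSet A → m A ∈ K) (B : Set Ω) : condMeasure μ m π B ∈ K :=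
  sum_smul_measure_mem hK hKc m hm π.parts (fun A => (A : Set Ω)) (fun A _ => A.2)
    (pairwiseDisjoint_parts π) _ (fun A _ => by positivity)
    fun A _ => measureReal_inter_div_le_one μ A B

/-- The difference `m_π - m` as a finitely additive set function. -/
noncomputable def condSub : FinAddMeasure Ω E :=
  isSetRing_measurableSet.addContent_of_union (fun B => condMeasure μ m π B - m B)
    (by simp [condMeasure]) fun {s t} hs ht hd => by
    rw [addContent_union isSetRing_measurableSet hs ht hd]
    have : condMeasure μ m π (s ∪ t) = condMeasure μ m π s + condMeasure μ m π t := by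
      simp only [condMeasure, ← Finset.sum_add_distrib]
      refine Finset.sum_congr rfl fun A _ => ?_
      rw [← add_smul, ← add_div, Set.inter_union_distrib_left,
        measureReal_union (hd.mono Set.inter_subset_right Set.inter_subset_right) (A.2.inter ht)]
    rw [this]
    abel

theorem condSub_apply (B : Set Ω) : condSub μ m π B = condMeasure μ m π B - m B := rfl

theorem coe_condSub : ⇑(condSub μ m π) = fun B => condMeasure μ m π B - m B := rfl

end contents

/-! ### Scalar case: Radon–Nikodym and convergence of conditional expectations -/

section scalar

variable {Ω : Type*} [MeasurableSpace Ω] {μ : Measure Ω} [IsFiniteMeasure μ]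

open scoped Classical in
/-- A real finitely additive set function which is absolutely continuous with respect to a finite
measure is a signed measure. -/
noncomputable def AbsCont.toSignedMeasure {ν : FinAddMeasure Ω ℝ} (h : AbsCont ν μ) :
    SignedMeasure Ω where
  measureOf' A := if MeasurableSet A then ν A else 0
  empty' := by simp
  not_measurable' A hA := by simp [hA]
  m_iUnion' f hf hd := by
    have hd' : ∀ S : Finset ℕ, (S : Set ℕ).PairwiseDisjoint f := fun S => hd.set_pairwise _
    have hμ : HasSum (fun i => μ.real (f i)) (μ.real (⋃ i, f i)) := by
      have h1 := (μ.toSignedMeasure).m_iUnion hf hd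
      simpa [hf, MeasurableSet.iUnion hf] using h1
    simp only [hf, MeasurableSet.iUnion hf, if_true]
    rw [HasSum, SummationFilter.unconditional_filter, Metric.tendsto_nhds] at *
    intro ε hε
    obtain ⟨δ, hδ, hνδ⟩ := h ε hε
    filter_upwards [hμ δ hδ] with S hS
    have hU : MeasurableSet (⋃ i ∈ S, f i) := Finset.measurableSet_biUnion S fun i _ => hf i
    have hsub : (⋃ i ∈ S, f i) ⊆ ⋃ i, f i := Set.iUnion₂_subset_iUnion _ _
    -- The remainder outside finitely many `f i` has small `μ`-measure, hence small `ν`-value.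
    have hdiff := hνδ ((⋃ i, f i) \ ⋃ i ∈ S, f i) ((MeasurableSet.iUnion hf).diff hU) (by
      rw [measureReal_sdiff hsub hU, measureReal_biUnion_finset (hd' S) fun i _ => hf i]
      rw [dist_comm, Real.dist_eq] at hS
      exact (le_abs_self _).trans_lt hS)
    have hadd := addContent_union isSetRing_measurableSet (m := ν) hU
      ((MeasurableSet.iUnion hf).diff hU) disjoint_sdiff_self_right
    rw [Set.union_sdiff_cancel hsub, measure_biUnion_eq_sum ν S f (fun i _ => hf i) (hd' S)] at hadd
    rw [dist_comm, Real.dist_eq, hadd, add_sub_cancel_left]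
    exact hdiff

theorem AbsCont.exists_density {ν : FinAddMeasure Ω ℝ} (h : AbsCont ν μ) :
    ∃ g : Ω → ℝ, Integrable g μ ∧ ∀ A, MeasurableSet A → ν A = ∫ x in A, g x ∂μ := by
  have happ : ∀ A, MeasurableSet A → h.toSignedMeasure A = ν A := fun A hA => if_pos hA
  have hac : VectorMeasure.AbsolutelyContinuous h.toSignedMeasure μ.toENNRealVectorMeasure := by
    refine VectorMeasure.AbsolutelyContinuous.mk fun A hA hμA => ?_
    rw [Measure.toENNRealVectorMeasure_apply_measurable hA] at hμA
    rw [happ A hA]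
    by_contra hne
    obtain ⟨δ, hδ, hνδ⟩ := h ‖ν A‖ (norm_pos_iff.mpr hne)
    exact lt_irrefl _ (hνδ A hA (by rwa [measureReal_def, hμA, ENNReal.toReal_zero]))
  rw [SignedMeasure.absolutelyContinuous_iff_withDensityᵥ_rnDeriv_eq] at hac
  refine ⟨h.toSignedMeasure.rnDeriv μ, SignedMeasure.integrable_rnDeriv _ _, fun A hA => ?_⟩
  rw [← withDensityᵥ_apply (SignedMeasure.integrable_rnDeriv _ _) hA, hac, happ A hA]

/-- For a real absolutely continuous `ν`, the conditional expectations `ν_π` converge to `ν`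
uniformly on measurable sets. -/
theorem AbsCont.eventually_condMeasure_sub_le {ν : FinAddMeasure Ω ℝ} (h : AbsCont ν μ) {ε : ℝ}
    (hε : 0 < ε) : ∀ᶠ π : Partition Ω in atBot,
      ∀ B, MeasurableSet B → |condMeasure μ ν π B - ν B| ≤ ε := by
  obtain ⟨g, hg, hνg⟩ := h.exists_density
  -- Once `π` refines the fibers of `s`, conditioning reproduces the part of `ν` with density `s`
  -- exactly. Only the remainder `k = g - s` is left, and it enters twice, hence `ε / 2`.
  obtain ⟨s, hs, hsint⟩ := (memLp_one_iff_integrable.mpr hg).exists_simpleFunc_eLpNorm_sub_lt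
    ENNReal.one_ne_top (ENNReal.ofReal_pos.mpr (half_pos hε)).ne'
  rw [memLp_one_iff_integrable] at hsint
  set k : Ω → ℝ := fun x => g x - s x
  have hk : Integrable k μ := hg.sub hsint
  have hkε : ∫ x, |k x| ∂μ ≤ ε / 2 := by
    have h1 : ∫ x, ‖k x‖ ∂μ = (eLpNorm k 1 μ).toReal := by
      rw [eLpNorm_one_eq_lintegral_enorm, integral_norm_eq_lintegral_enorm hk.1]
    refine h1.le.trans ?_
    exact ENNReal.toReal_le_of_le_ofReal (half_pos hε).le hs.le
  filter_upwards [eventually_le_atBot (fiberPartition s)] with π hπ B hB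
  have hsum : ν B = ∑ A ∈ π.parts, ν ((A : Set Ω) ∩ B) := by
    rw [← measure_biUnion_eq_sum ν _ _ (fun A _ => A.2.inter hB)
      ((pairwiseDisjoint_parts π).mono fun A => Set.inter_subset_left), ← Set.iUnion₂_inter,
      iUnion_parts, Set.univ_inter]
  have hterm : ∀ A ∈ π.parts, |(μ.real ((A : Set Ω) ∩ B) / μ.real (A : Set Ω)) • ν (A : Set Ω)
      - ν ((A : Set Ω) ∩ B)| ≤ 2 * ∫ x in (A : Set Ω), |k x| ∂μ := by
    intro A hA
    obtain ⟨r, hr⟩ := exists_eqOn_of_le_fiberPartition s hπ hA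
    have key : ∀ C : Set Ω, MeasurableSet C → C ⊆ A →
        ν C = (∫ x in C, k x ∂μ) + r * μ.real C ∧
          |∫ x in C, k x ∂μ| ≤ ∫ x in (A : Set Ω), |k x| ∂μ := by
      intro C hC hCA
      constructor
      · have h1 : ∫ x in C, s x ∂μ = r * μ.real C := by
          rw [setIntegral_congr_fun hC fun x hx => hr x (hCA hx)]
          simp [mul_comm]
        rw [hνg C hC, ← h1, ← integral_add hk.integrableOn hsint.integrableOn]
        simp [k]
      · exact (abs_integral_le_integral_abs).trans
          (setIntegral_mono_set hk.abs.integrableOn (ae_of_all _ fun x => abs_nonneg _)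
            hCA.eventuallyLE)
    obtain ⟨h1, h2⟩ := key A A.2 subset_rfl
    obtain ⟨h3, h4⟩ := key (A ∩ B) (A.2.inter hB) Set.inter_subset_left
    set t := μ.real ((A : Set Ω) ∩ B) / μ.real (A : Set Ω)
    have ht0 : 0 ≤ t := by positivity
    have ht1 : t ≤ 1 := measureReal_inter_div_le_one μ A B
    -- On a null cell both sides vanish, so the convention `0 / 0 = 0` is harmless.
    have ht : t * μ.real (A : Set Ω) = μ.real ((A : Set Ω) ∩ B) := by
      refine div_mul_cancel_of_imp fun h0 => ?_
      exact le_antisymm ((measureReal_mono Set.inter_subset_left).trans h0.le) measureReal_nonneg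
    have hrw : t • ν (A : Set Ω) - ν ((A : Set Ω) ∩ B)
        = t * (∫ x in (A : Set Ω), k x ∂μ) - ∫ x in (A : Set Ω) ∩ B, k x ∂μ := by
      rw [h1, h3, ← ht, smul_eq_mul]
      ring
    rw [hrw]
    have h5 : |t * ∫ x in (A : Set Ω), k x ∂μ| ≤ ∫ x in (A : Set Ω), |k x| ∂μ := by
      rw [abs_mul, abs_of_nonneg ht0]
      exact (mul_le_of_le_one_left (abs_nonneg _) ht1).trans h2
    have := abs_sub (t * ∫ x in (A : Set Ω), k x ∂μ) (∫ x in (A : Set Ω) ∩ B, k x ∂μ)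
    linarith
  calc |condMeasure μ ν π B - ν B|
      ≤ ∑ A ∈ π.parts, 2 * ∫ x in (A : Set Ω), |k x| ∂μ := by
        rw [hsum, condMeasure, ← Finset.sum_sub_distrib]
        exact (Finset.abs_sum_le_sum_abs _ _).trans (Finset.sum_le_sum hterm)
    _ = 2 * ∫ x, |k x| ∂μ := by
        rw [← Finset.mul_sum, ← integral_biUnion_finset _ (fun A _ => A.2)
          (pairwiseDisjoint_parts π) fun A _ => hk.abs.integrableOn, iUnion_parts,
          setIntegral_univ]
    _ ≤ ε := by linarith

end scalar

/-! ### Vector case: convergence in semivariation and compact range -/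

section vector

variable {Ω : Type*} [MeasurableSpace Ω] {μ : Measure Ω} [IsFiniteMeasure μ]
  {E : Type*} [NormedAddCommGroup E] [NormedSpace ℝ E] {m : FinAddMeasure Ω E}

/-- The closed convex hull of a relatively compact range is compact. -/
theorem HasRelCompactRange.exists_isCompact_convex [CompleteSpace E] (h : HasRelCompactRange m) :
    ∃ K : Set E, IsCompact K ∧ Convex ℝ K ∧ ∀ A, MeasurableSet A → m A ∈ K := by
  refine ⟨closure (convexHull ℝ {y : E | ∃ A : Set Ω, MeasurableSet A ∧ m A = y}), ?_,
    (convex_convexHull ℝ _).closure, fun A hA =>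
      subset_closure (subset_convexHull ℝ _ ⟨A, hA, rfl⟩)⟩
  have h1 : TotallyBounded {y : E | ∃ A : Set Ω, MeasurableSet A ∧ m A = y} :=
    h.totallyBounded.subset subset_closure
  exact (totallyBounded_convexHull.mpr h1).closure.isCompact_of_isClosed isClosed_closure

theorem tendsto_semivariation_of_hasRelCompactRange [CompleteSpace E] (hμ : AbsCont m μ)
    (h : HasRelCompactRange m) :
    Tendsto (fun π : Partition Ω => semivariation (fun B => condMeasure μ m π B - m B) ⊤)
      atBot (𝓝 0) := by
  obtain ⟨K, hK, hKconv, hmK⟩ := h.exists_isCompact_convex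
  rw [ENNReal.tendsto_nhds_zero]
  intro ε hε
  -- The 3 comes from `exists_finset_functional_norm_le`, the 2 from `semivariation_le`.
  obtain ⟨η, hη, hηε⟩ : ∃ η : ℝ, 0 < η ∧ ENNReal.ofReal (2 * (3 * η)) ≤ ε := by
    rcases eq_or_ne ε ∞ with rfl | hne
    · exact ⟨1, one_pos, le_top⟩
    · refine ⟨ε.toReal / 6, div_pos (ENNReal.toReal_pos hε.ne' hne) (by norm_num), ?_⟩
      rw [show 2 * (3 * (ε.toReal / 6)) = ε.toReal by ring, ENNReal.ofReal_toReal hne]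
  obtain ⟨t, ht⟩ := exists_finset_functional_norm_le (isCompact_sub_self hK) hη
  have hev : ∀ᶠ π : Partition Ω in atBot, ∀ φ ∈ t, ∀ B, MeasurableSet B →
      |condMeasure μ (compMeasure φ m) π B - compMeasure φ m B| ≤ η :=
    (Filter.eventually_all_finset t).mpr fun φ _ => (hμ.comp φ).eventually_condMeasure_sub_le hη
  filter_upwards [hev] with π hπ
  refine le_trans ?_ hηε
  rw [← coe_condSub]
  refine semivariation_le _ (fun B hB => ?_) _
  refine ht _ (Set.sub_mem_sub (condMeasure_mem μ m π hKconv hK.isClosed hmK B) (hmK B hB))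
    fun φ hφ => ?_
  have := hπ φ hφ B hB
  rwa [← map_condMeasure, compMeasure_apply, ← map_sub] at this

theorem hasRelCompactRange_of_tendsto_semivariation [CompleteSpace E]
    (h : Tendsto (fun π : Partition Ω => semivariation (fun B => condMeasure μ m π B - m B) ⊤)
      atBot (𝓝 0)) : HasRelCompactRange m := by
  classical
  refine TotallyBounded.isCompact_of_isClosed (TotallyBounded.closure ?_) isClosed_closure
  rw [Metric.totallyBounded_iff]
  intro ε hε
  obtain ⟨π, hπ⟩ := (ENNReal.tendsto_nhds_zero.mp h (ENNReal.ofReal (ε / 3))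
    (ENNReal.ofReal_pos.mpr (by positivity))).exists
  -- All values of `m_π` lie in the image under `Φ` of a cube. The cube has a coordinate for every
  -- measurable set and is compact by Tychonoff; only the coordinates in `π` matter.
  set Φ : ({s : Set Ω // MeasurableSet s} → ℝ) → E := fun c => ∑ A ∈ π.parts, c A • m A
  have hΦ : Continuous Φ := by fun_prop
  have hC : IsCompact (Φ '' Set.univ.pi fun _ => Set.Icc 0 1) :=
    (isCompact_univ_pi fun _ => isCompact_Icc).image hΦ
  obtain ⟨t, htfin, ht⟩ := Metric.totallyBounded_iff.mp hC.totallyBounded (ε / 2) (by positivity)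
  refine ⟨t, htfin, ?_⟩
  rintro _ ⟨B, hB, rfl⟩
  have hmem : condMeasure μ m π B ∈ Φ '' Set.univ.pi fun _ => Set.Icc 0 1 :=
    ⟨fun A => μ.real ((A : Set Ω) ∩ B) / μ.real (A : Set Ω),
      fun A _ => ⟨by positivity, measureReal_inter_div_le_one μ A B⟩, rfl⟩
  obtain ⟨y, hy, hyB⟩ := Set.mem_iUnion₂.mp (ht hmem)
  refine Set.mem_iUnion₂.mpr ⟨y, hy, ?_⟩
  have h1 : ‖condMeasure μ m π B - m B‖ ≤ ε / 3 := by
    have := (enorm_le_semivariation (condSub μ m π) hB).trans hπ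
    rwa [condSub_apply, ← ofReal_norm, ENNReal.ofReal_le_ofReal_iff (by positivity)] at this
  rw [← dist_eq_norm, dist_comm] at h1
  rw [Metric.mem_ball] at hyB ⊢
  linarith [dist_triangle (m B) (condMeasure μ m π B) y]

end vector

/-! ### Approximation by simple functions -/

section approximation

variable {Ω : Type*} [MeasurableSpace Ω]

/-- Measurable functions bounded by one are uniform limits of simple functions bounded by one. -/
theorem exists_simpleFunc_abs_sub_le {f : Ω → ℝ} (hf : Measurable f) (hf1 : ∀ x, |f x| ≤ 1)
    {δ : ℝ} (hδ : 0 < δ) :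
    ∃ s : SimpleFunc Ω ℝ, (∀ x, |s x - f x| ≤ δ) ∧ ∀ x, |s x| ≤ 1 := by
  -- Round `f` down to a multiple of `δ`; only the lower bound `-1` can then fail, so it is enforced
  -- by clipping.
  have hmeas : Measurable fun x => max (-1) (δ * (⌊f x / δ⌋ : ℝ)) := by
    have h1 : Measurable fun x => ⌊f x / δ⌋ := Int.measurable_floor.comp (hf.div_const δ)
    have h2 : Measurable fun x => ((⌊f x / δ⌋ : ℤ) : ℝ) := measurable_from_top.comp h1
    exact measurable_const.max (h2.const_mul δ)
  have hle : ∀ x, δ * (⌊f x / δ⌋ : ℝ) ≤ f x := fun x => by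
    have h := Int.floor_le (f x / δ)
    rw [le_div_iff₀ hδ] at h
    linarith
  have hlt : ∀ x, f x - δ ≤ δ * (⌊f x / δ⌋ : ℝ) := fun x => by
    have h := (Int.lt_floor_add_one (f x / δ)).le
    rw [div_le_iff₀ hδ] at h
    linarith
  refine ⟨⟨_, fun r => hmeas (measurableSet_singleton r), ?_⟩, fun x => ?_, fun x => ?_⟩
  · refine ((Set.finite_Icc ⌊-1 / δ⌋ ⌊1 / δ⌋).image
      fun n : ℤ => max (-1) (δ * (n : ℝ))).subset ?_
    rintro _ ⟨x, rfl⟩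
    obtain ⟨h1, h2⟩ := abs_le.mp (hf1 x)
    exact ⟨⌊f x / δ⌋, ⟨by gcongr, by gcongr⟩, rfl⟩
  · have h1 := (abs_le.mp (hf1 x)).1
    rw [SimpleFunc.coe_mk, abs_le]
    constructor
    · linarith [hlt x, le_max_right (-1) (δ * (⌊f x / δ⌋ : ℝ))]
    · linarith [max_le h1 (hle x)]
  · rw [SimpleFunc.coe_mk, abs_le]
    exact ⟨le_max_left _ _, max_le (by norm_num) ((hle x).trans (abs_le.mp (hf1 x)).2)⟩

/-- If `ν` is dominated by `κ`, then `∫ s dν` and `ν A` differ by at most the `L¹(κ)` distance of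
`s` and the indicator of `A`. -/
theorem abs_sum_sub_le_integral (κ : Measure Ω) [IsFiniteMeasure κ] (ν : FinAddMeasure Ω ℝ)
    (hν : ∀ A, MeasurableSet A → |ν A| ≤ κ.real A) (s : SimpleFunc Ω ℝ) {A : Set Ω}
    (hA : MeasurableSet A) :
    |simpleIntegral ν s - ν A| ≤ ∫ x, |s x - A.indicator 1 x| ∂κ := by
  -- Viewing `ν` as operator-valued makes linearity and the `L¹(κ)` bound instances of the theory of
  -- `setToSimpleFunc`.
  set Tν : Set Ω → ℝ →L[ℝ] ℝ := fun B => ContinuousLinearMap.toSpanSingleton ℝ (ν B)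
  have hadd : FinMeasAdditive κ Tν := by
    intro B C hB hC _ _ hBC
    simp only [Tν]
    rw [addContent_union isSetRing_measurableSet hB hC hBC,
      ContinuousLinearMap.toSpanSingleton_add]
  have hnorm : ∀ B, MeasurableSet B → κ B < ∞ → ‖Tν B‖ ≤ 1 * κ.real B := fun B hB _ => by
    simpa [Tν] using hν B hB
  set i : SimpleFunc Ω ℝ := SimpleFunc.piecewise A hA (SimpleFunc.const Ω 1) (SimpleFunc.const Ω 0)
  have hi : ν A = i.setToSimpleFunc Tν := by
    rw [SimpleFunc.setToSimpleFunc_indicator Tν (by simp [Tν]) hA]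
    simp [Tν]
  have hs : simpleIntegral ν s = s.setToSimpleFunc Tν := by
    simp [simpleIntegral, SimpleFunc.setToSimpleFunc, Tν]
  rw [hi, hs, ← SimpleFunc.setToSimpleFunc_sub Tν hadd (SimpleFunc.integrable_of_isFiniteMeasure s)
    (SimpleFunc.integrable_of_isFiniteMeasure i)]
  have h1 := SimpleFunc.norm_setToSimpleFunc_le_sum_mul_norm_of_integrable Tν hnorm (s - i)
    (SimpleFunc.integrable_of_isFiniteMeasure _)
  rw [one_mul] at h1
  refine h1.trans (le_of_eq ?_)
  have h2 := SimpleFunc.map_integral (s - i) (fun y => |y|)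
    (SimpleFunc.integrable_of_isFiniteMeasure (μ := κ) _) (by simp)
  have h3 : ∫ x, |s x - A.indicator 1 x| ∂κ = ∫ x, ((s - i).map fun y => |y|) x ∂κ := by
    refine integral_congr_ae (ae_of_all _ fun x => ?_)
    by_cases hx : x ∈ A <;> simp [i, hx]
  rw [h3, ← SimpleFunc.integral_eq_integral _ (SimpleFunc.integrable_of_isFiniteMeasure _), h2]
  simp [smul_eq_mul]

theorem simpleIntegral_comp {E : Type*} [NormedAddCommGroup E] [NormedSpace ℝ E]
    {m : FinAddMeasure Ω E} {G : Type*} [NormedAddCommGroup G] [NormedSpace ℝ G]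
    (φ : E →L[ℝ] G) (s : SimpleFunc Ω ℝ) :
    φ (simpleIntegral m s) = simpleIntegral (compMeasure φ m) s := by
  simp [simpleIntegral, map_sum]

/-- The integral of a simple function against `m_π`. -/
theorem sum_smul_condMeasure {E : Type*} [NormedAddCommGroup E] [NormedSpace ℝ E]
    (m : FinAddMeasure Ω E) (μ : Measure Ω) [IsFiniteMeasure μ] (π : Partition Ω)
    (s : SimpleFunc Ω ℝ) :
    ∑ r ∈ s.range, r • condMeasure μ m π (s ⁻¹' {r}) =
      ∑ A ∈ π.parts, ((∫ x in (A : Set Ω), s x ∂μ) / μ.real (A : Set Ω)) • m (A : Set Ω) := by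
  simp only [condMeasure, Finset.smul_sum]
  rw [Finset.sum_comm]
  refine Finset.sum_congr rfl fun A _ => ?_
  simp only [smul_smul]
  rw [← Finset.sum_smul]
  congr 1
  rw [← SimpleFunc.integral_eq_integral _ (SimpleFunc.integrable_of_isFiniteMeasure s),
    SimpleFunc.integral_eq, Finset.sum_div]
  refine Finset.sum_congr rfl fun r _ => ?_
  rw [measureReal_restrict_apply (s.measurableSet_fiber r), Set.inter_comm, smul_eq_mul]
  ring

end approximation

/-! ### Evaluation functionals on the bidual -/

section bidual

variable {Y : Type*} [NormedAddCommGroup Y] [NormedSpace ℝ Y]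

instance : CompleteSpace (Bidual Y) :=
  inferInstanceAs (CompleteSpace (StrongDual ℝ (StrongDual ℝ Y)))

/-- Evaluation at `φ ∈ Y*` as a functional on the bidual. -/
noncomputable def pairCLM (φ : StrongDual ℝ Y) : Bidual Y →L[ℝ] ℝ :=
  (ContinuousLinearMap.apply ℝ ℝ φ : StrongDual ℝ (StrongDual ℝ Y) →L[ℝ] ℝ)

theorem pairCLM_apply (φ : StrongDual ℝ Y) (z : Bidual Y) : pairCLM φ z = z.pair φ := rfl

theorem Bidual.ext_pair {z w : Bidual Y} (h : ∀ φ, z.pair φ = w.pair φ) : z = w :=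
  ContinuousLinearMap.ext (f := (z : StrongDual ℝ (StrongDual ℝ Y))) h

end bidual

/-! ### Integrals and the operators `T_π` -/

section general

variable {H : Type*} [TopologicalSpace H] [CompactSpace H] [MeasurableSpace H] [BorelSpace H]
  {E : Type*} [NormedAddCommGroup E] [NormedSpace ℝ E] {m : FinAddMeasure H E}

/-- If the values of `m` lie in a closed convex set `K`, its integrals of functions of norm at most
one lie in `K - K` when this set is closed. -/
theorem HasIntegral.mem_sub {K : Set E} (hK : Convex ℝ K) (hKc : IsClosed K)
    (hKs : IsClosed (K - K)) (hm : ∀ A, MeasurableSet A → m A ∈ K) {f : C(H, ℝ)} (hf : ‖f‖ ≤ 1)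
    {I : E} (hI : HasIntegral m f I) : I ∈ K - K := by
  refine hKs.closure_subset (Metric.mem_closure_iff.mpr fun ε hε => ?_)
  obtain ⟨δ, hδ, h⟩ := hI (ε / 2) (half_pos hε)
  obtain ⟨s, hs, hs1⟩ := exists_simpleFunc_abs_sub_le f.continuous.measurable
    (fun x => (f.norm_coe_le_norm x).trans hf) hδ
  refine ⟨_, simpleIntegral_mem_sub hK hKc m hm s hs1, ?_⟩
  rw [dist_comm, dist_eq_norm]
  exact (h s hs).trans_lt (half_lt_self hε)

variable (μ : Measure H) [IsFiniteMeasure μ] (m) (π : Partition H)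

/-- The bound depends on `π`, which is harmless: `δ` is chosen after `π`. -/
theorem norm_condOperator_sub_sum_le (f : C(H, ℝ)) (s : SimpleFunc H ℝ) {δ : ℝ} (hδ : 0 ≤ δ)
    (hs : ∀ x, |s x - f x| ≤ δ) :
    ‖condOperator μ m π f - ∑ r ∈ s.range, r • condMeasure μ m π (s ⁻¹' {r})‖ ≤
      δ * ∑ A ∈ π.parts, ‖m (A : Set H)‖ := by
  rw [condOperator_apply, sum_smul_condMeasure, ← Finset.sum_sub_distrib, Finset.mul_sum]
  refine norm_sum_le_of_le _ fun A _ => ?_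
  rw [← sub_smul, ← sub_div, norm_smul]
  refine mul_le_mul_of_nonneg_right ?_ (norm_nonneg _)
  have hf : Integrable f (μ.restrict A) :=
    Integrable.of_bound f.continuous.aestronglyMeasurable ‖f‖ (ae_of_all _ f.norm_coe_le_norm)
  rw [← integral_sub hf (SimpleFunc.integrable_of_isFiniteMeasure s), norm_div,
    Real.norm_of_nonneg measureReal_nonneg]
  refine div_le_of_le_mul₀ measureReal_nonneg hδ ?_
  have h := norm_integral_le_of_norm_le_const (μ := μ.restrict A) (f := fun x => f x - s x)
    (ae_of_all _ fun x => by rw [Real.norm_eq_abs, abs_sub_comm]; exact hs x)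
  simpa using h

/-- `‖T_π - T‖` is at most twice the supremum of `‖m_π A - m A‖`. -/
theorem norm_condOperator_sub_le {T : C(H, ℝ) →L[ℝ] E} (hT : ∀ f : C(H, ℝ), HasIntegral m f (T f))
    {M : ℝ} (hM : ∀ A, MeasurableSet A → ‖condMeasure μ m π A - m A‖ ≤ M) :
    ‖condOperator μ m π - T‖ ≤ 2 * M := by
  have hM0 : 0 ≤ M := (norm_nonneg _).trans (hM ∅ MeasurableSet.empty)
  refine ContinuousLinearMap.opNorm_le_of_unit_norm (by positivity) fun f hf => ?_
  refine le_of_forall_pos_le_add fun ε hε => ?_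
  set C := ∑ A ∈ π.parts, ‖m (A : Set H)‖
  have hC : 0 ≤ C := by positivity
  obtain ⟨δ, hδ, h⟩ := hT f (ε / 2) (half_pos hε)
  -- The first bound makes `∫ s dm` close to `T f`, the second makes `∫ s dm_π` close to `T_π f`,
  -- each within `ε / 2`.
  have hη : 0 < min δ (ε / 2 / (C + 1)) := by positivity
  obtain ⟨s, hs, hs1⟩ := exists_simpleFunc_abs_sub_le f.continuous.measurable
    (fun x => (f.norm_coe_le_norm x).trans hf.le) hη
  have h1 := h s fun x => (hs x).trans (min_le_left _ _)
  have h2 := norm_condOperator_sub_sum_le m μ π f s hη.le hs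
  have h3 := norm_simpleIntegral_le (condSub μ m π) hM s hs1
  have h4 : min δ (ε / 2 / (C + 1)) * C ≤ ε / 2 := by
    calc min δ (ε / 2 / (C + 1)) * C ≤ ε / 2 / (C + 1) * (C + 1) := by
          gcongr
          · exact min_le_right _ _
          · linarith
      _ = ε / 2 := by field_simp
  have h5 : simpleIntegral (condSub μ m π) s =
      ∑ r ∈ s.range, r • condMeasure μ m π (s ⁻¹' {r}) - simpleIntegral m s := by
    simp [simpleIntegral, condSub_apply, smul_sub]
  have h6 : (condOperator μ m π - T) f =
      (condOperator μ m π f - ∑ r ∈ s.range, r • condMeasure μ m π (s ⁻¹' {r})) +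
        simpleIntegral (condSub μ m π) s + (simpleIntegral m s - T f) := by
    rw [h5, sub_apply]
    abel
  rw [h6]
  refine (norm_add₃_le).trans ?_
  linarith

/-- A finite sum of operators factoring through `ℝ`. -/
theorem isCompactOperator_condOperator : IsCompactOperator (condOperator μ m π) := by
  change condOperator μ m π ∈ compactOperator (RingHom.id ℝ) C(H, ℝ) E
  refine Submodule.sum_mem _ fun A _ => ?_
  exact (isCompactOperator_of_locallyCompactSpace_rng
    (ContinuousLinearMap.toSpanSingleton ℝ (m (A : Set H)))).comp_clm
      ((μ.real (A : Set H))⁻¹ • setIntegralFunctional μ (A : Set H))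

end general

/-! ### The representing measure and compactness of the operator -/

section representation

variable {H : Type*} [TopologicalSpace H] [MeasurableSpace H] [BorelSpace H]
  {Y : Type*} [NormedAddCommGroup Y] [NormedSpace ℝ Y] {T : C(H, ℝ) →L[ℝ] Y}
  {m : FinAddMeasure H (Bidual Y)}

/-- If `f` is one on `C`, zero outside `U` and `C ⊆ A ⊆ U`, then `⟨T f, φ⟩` approximates
`⟨m A, φ⟩` up to the variation of `⟨m, φ⟩` on `U \ C`. -/
theorem abs_pair_sub_pair_le (hT : ∀ f : C(H, ℝ), HasIntegral m f (toBidual Y (T f)))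
    {φ : StrongDual ℝ Y} {κ : Measure H} [IsFiniteMeasure κ]
    (hκ : ∀ A, MeasurableSet A → |(m A).pair φ| ≤ κ.real A) {A C U : Set H}
    (hA : MeasurableSet A) (hC : MeasurableSet C) (hU : MeasurableSet U) (hCA : C ⊆ A)
    (hAU : A ⊆ U) {f : C(H, ℝ)} (hf : ∀ x, f x ∈ Set.Icc (0 : ℝ) 1) (hf1 : ∀ x ∈ C, f x = 1)
    (hf0 : ∀ x ∉ U, f x = 0) :
    |(toBidual Y (T f)).pair φ - (m A).pair φ| ≤ κ.real (U \ C) := by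
  refine le_of_forall_pos_le_add fun ε hε => ?_
  set N := ‖pairCLM φ‖
  have hN : 0 ≤ N := norm_nonneg _
  obtain ⟨δ, hδ, h⟩ := hT f (ε / 2 / (N + 1)) (by positivity)
  set η := min δ (ε / 2 / (κ.real Set.univ + 1))
  have hη : 0 < η := by positivity
  obtain ⟨s, hs, hs1⟩ := exists_simpleFunc_abs_sub_le f.continuous.measurable
    (fun x => abs_le.mpr ⟨by linarith [(hf x).1], (hf x).2⟩) hη
  have h1 : |(toBidual Y (T f)).pair φ - simpleIntegral (compMeasure (pairCLM φ) m) s| ≤ ε / 2 := by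
    rw [← simpleIntegral_comp, ← pairCLM_apply, ← map_sub, ← Real.norm_eq_abs]
    calc ‖pairCLM φ (toBidual Y (T f) - simpleIntegral m s)‖
        ≤ N * ‖toBidual Y (T f) - simpleIntegral m s‖ := (pairCLM φ).le_opNorm _
      _ ≤ (N + 1) * (ε / 2 / (N + 1)) := by
          gcongr
          · linarith
          · rw [norm_sub_rev]
            exact h s fun x => (hs x).trans (min_le_left _ _)
      _ = ε / 2 := by field_simp
  have h2 := abs_sum_sub_le_integral κ (compMeasure (pairCLM φ) m) hκ s hA
  have hind : Integrable ((U \ C).indicator (1 : H → ℝ)) κ :=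
    (integrable_const (1 : ℝ)).indicator (hU.diff hC)
  have hint : Integrable (fun x => η + (U \ C).indicator (1 : H → ℝ) x) κ :=
    (integrable_const η).add hind
  have h3 : ∫ x, |s x - A.indicator 1 x| ∂κ ≤ ∫ x, (η + (U \ C).indicator (1 : H → ℝ) x) ∂κ := by
    refine integral_mono_of_nonneg (ae_of_all _ fun x => abs_nonneg _) hint
      (ae_of_all _ fun x => ?_)
    -- The two functions agree on `C` and off `U`; in between both take values in `[0, 1]`.
    have h4 : |f x - A.indicator 1 x| ≤ (U \ C).indicator (1 : H → ℝ) x := by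
      obtain ⟨hx0, hx1⟩ := hf x
      by_cases hxC : x ∈ C
      · simp [hf1 x hxC, hCA hxC, hxC]
      by_cases hxU : x ∈ U
      · by_cases hxA : x ∈ A <;> simp [hxA, hxU, hxC] <;> rw [abs_le] <;> constructor <;> linarith
      · have hxA : x ∉ A := fun hxA => hxU (hAU hxA)
        simp [hf0 x hxU, hxA, hxU]
    calc |s x - A.indicator 1 x| ≤ |s x - f x| + |f x - A.indicator 1 x| := abs_sub_le _ _ _
      _ ≤ _ := add_le_add (hs x) h4
  have h5 : ∫ x, (η + (U \ C).indicator (1 : H → ℝ) x) ∂κ =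
      η * κ.real Set.univ + κ.real (U \ C) := by
    rw [integral_add (integrable_const η) hind,
      integral_indicator_one (hU.diff hC)]
    simp [mul_comm]
  have h6 : η * κ.real Set.univ ≤ ε / 2 := by
    calc η * κ.real Set.univ
        ≤ ε / 2 / (κ.real Set.univ + 1) * (κ.real Set.univ + 1) := by
          gcongr
          · exact min_le_right _ _
          · linarith
      _ = ε / 2 := by field_simp
  have h7 := abs_sub_le ((toBidual Y (T f)).pair φ) (simpleIntegral (compMeasure (pairCLM φ) m) s)
    ((m A).pair φ)
  have h8 : compMeasure (pairCLM φ) m A = (m A).pair φ := rfl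
  rw [h8] at h2
  linarith

variable [CompactSpace H]

/-- Every value `m A` is a weak* limit of values of `T` on the unit ball. -/
theorem exists_norm_le_one_abs_pair_sub_le [T2Space H] (h : Represents m T)
    (t : Finset (StrongDual ℝ Y)) {A : Set H} (hA : MeasurableSet A) {ε : ℝ} (hε : 0 < ε) :
    ∃ f : C(H, ℝ), ‖f‖ ≤ 1 ∧ ∀ φ ∈ t, |(toBidual Y (T f)).pair φ - (m A).pair φ| ≤ ε := by
  choose ν hreg hν using h.1
  have hκ : ∀ φ, ∀ B, MeasurableSet B → |(m B).pair φ| ≤ (ν φ).variation.real B := fun φ B hB => by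
    have := hreg φ
    rw [← hν φ B hB]
    exact VectorMeasure.norm_measure_le_variation (measure_ne_top (ν φ).variation B)
  have hε2 : ENNReal.ofReal (ε / 2) ≠ 0 := (ENNReal.ofReal_pos.mpr (half_pos hε)).ne'
  have hC : ∀ φ, ∃ C ⊆ A, IsClosed C ∧ (ν φ).variation (A \ C) < ENNReal.ofReal (ε / 2) :=
    fun φ => by
      have := hreg φ
      exact hA.exists_isClosed_sdiff_lt (measure_ne_top _ _) hε2
  have hU : ∀ φ, ∃ U, A ⊆ U ∧ IsOpen U ∧ (ν φ).variation (U \ A) < ENNReal.ofReal (ε / 2) :=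
    fun φ => by
      have := hreg φ
      obtain ⟨U, h1, h2, -, h3⟩ := hA.exists_isOpen_sdiff_lt
        (measure_ne_top (ν φ).variation _) hε2
      exact ⟨U, h1, h2, h3⟩
  choose C hCA hCc hCm using hC
  choose U hUA hUo hUm using hU
  -- One `f` must serve all `φ ∈ t`: enlarging the closed sets to their union and shrinking the open
  -- sets to their intersection only reduces the gap for each `φ`.
  have hCc' : IsClosed (⋃ φ ∈ t, C φ) := t.finite_toSet.isClosed_biUnion fun φ _ => hCc φ
  have hUo' : IsOpen (⋂ φ ∈ t, U φ) := isOpen_biInter_finset fun φ _ => hUo φ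
  have hCA' : (⋃ φ ∈ t, C φ) ⊆ A := Set.iUnion₂_subset fun φ _ => hCA φ
  have hUA' : A ⊆ ⋂ φ ∈ t, U φ := Set.subset_iInter₂ fun φ _ => hUA φ
  obtain ⟨f, hf0, hf1, hf⟩ := exists_continuous_zero_one_of_isClosed hUo'.isClosed_compl hCc'
    (Set.disjoint_compl_left_iff_subset.mpr (hCA'.trans hUA'))
  refine ⟨f, (ContinuousMap.norm_le _ zero_le_one).mpr fun x => ?_, fun φ hφ => ?_⟩
  · rw [Real.norm_of_nonneg (hf x).1]
    exact (hf x).2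
  · have := hreg φ
    refine (abs_pair_sub_pair_le h.2 (hκ φ) hA hCc'.measurableSet hUo'.measurableSet hCA' hUA' hf
      (fun x hx => hf1 hx) fun x hx => hf0 hx).trans ?_
    have hsub : (⋂ ψ ∈ t, U ψ) \ (⋃ ψ ∈ t, C ψ) ⊆ (U φ \ A) ∪ (A \ C φ) := by
      rintro x ⟨hxU, hxC⟩
      by_cases hxA : x ∈ A
      · exact Or.inr ⟨hxA, fun hx => hxC (Set.mem_biUnion hφ hx)⟩
      · exact Or.inl ⟨Set.mem_iInter₂.mp hxU φ hφ, hxA⟩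
    have hreal : ∀ B, (ν φ).variation B < ENNReal.ofReal (ε / 2) →
        (ν φ).variation.real B ≤ ε / 2 := fun B hB =>
      ENNReal.toReal_le_of_le_ofReal (half_pos hε).le hB.le
    calc (ν φ).variation.real ((⋂ ψ ∈ t, U ψ) \ (⋃ ψ ∈ t, C ψ))
        ≤ (ν φ).variation.real ((U φ \ A) ∪ (A \ C φ)) := measureReal_mono hsub
      _ ≤ (ν φ).variation.real (U φ \ A) + (ν φ).variation.real (A \ C φ) :=
          measureReal_union_le _ _
      _ ≤ ε := by linarith [hreal _ (hUm φ), hreal _ (hCm φ)]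

/-- Norm compactness lets finitely many functionals in `Y*` separate a point outside `K` from all of
`K`, which contradicts weak* approximation. -/
theorem hasRelCompactRange_of_isCompactOperator [T2Space H] (h : Represents m T)
    (hT : IsCompactOperator T) : HasRelCompactRange m := by
  classical
  set K : Set (Bidual Y) := toBidual Y '' closure (T '' Metric.closedBall 0 1)
  have hK : IsCompact K :=
    (IsCompactOperator.isCompact_closure_image_closedBall (f := (T : C(H, ℝ) →ₗ[ℝ] Y)) hT 1).image
      (toBidual Y).continuous
  have hTK : ∀ f : C(H, ℝ), ‖f‖ ≤ 1 → toBidual Y (T f) ∈ K := fun f hf =>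
    ⟨T f, subset_closure ⟨f, mem_closedBall_zero_iff.mpr hf, rfl⟩, rfl⟩
  refine hK.closure_of_subset ?_
  rintro _ ⟨A, hA, rfl⟩
  by_contra hmem
  have hcov : K ⊆ ⋃ φ : StrongDual ℝ Y, {z : Bidual Y | pairCLM φ z ≠ (m A).pair φ} := by
    intro z hz
    by_contra hcon
    simp only [Set.mem_iUnion, Set.mem_ofPred_eq, not_exists, not_not] at hcon
    exact hmem (Bidual.ext_pair hcon ▸ hz)
  obtain ⟨t, ht⟩ := hK.elim_finite_subcover _
    (fun φ => isOpen_ne_fun (pairCLM φ).continuous continuous_const) hcov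
  have hcont : Continuous fun z : Bidual Y => ∑ φ ∈ t, |pairCLM φ z - (m A).pair φ| := by
    fun_prop
  obtain ⟨z₀, hz₀, hmin⟩ := hK.exists_isMinOn ⟨_, hTK 0 (by simp)⟩ hcont.continuousOn
  set d := ∑ φ ∈ t, |pairCLM φ z₀ - (m A).pair φ|
  have hd : 0 < d := by
    obtain ⟨φ, hφ, hne⟩ := Set.mem_iUnion₂.mp (ht hz₀)
    exact Finset.sum_pos' (fun _ _ => abs_nonneg _) ⟨φ, hφ, abs_pos.mpr (sub_ne_zero.mpr hne)⟩
  -- With `t.card` errors of at most `d / (t.card + 1)`, the sum falls below its minimum `d` on `K`.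
  obtain ⟨f, hf, hfφ⟩ := exists_norm_le_one_abs_pair_sub_le h t hA
    (ε := d / (t.card + 1)) (by positivity)
  have h1 : d ≤ ∑ φ ∈ t, |pairCLM φ (toBidual Y (T f)) - (m A).pair φ| := hmin (hTK f hf)
  have h2 : ∑ φ ∈ t, |pairCLM φ (toBidual Y (T f)) - (m A).pair φ| ≤
      t.card * (d / (t.card + 1)) := by
    rw [← nsmul_eq_mul]
    exact Finset.sum_le_card_nsmul _ _ _ hfφ
  have h3 : t.card * (d / (t.card + 1)) < d := by
    rw [← mul_div_assoc, div_lt_iff₀ (by positivity)]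
    linarith
  linarith

/-- If `m` has relatively compact range, then the represented operator is compact. -/
theorem isCompactOperator_of_hasRelCompactRange [CompleteSpace Y] (h : Represents m T)
    (hm : HasRelCompactRange m) : IsCompactOperator T := by
  obtain ⟨K, hK, hKconv, hmK⟩ := hm.exists_isCompact_convex
  have hKs := isCompact_sub_self hK
  -- Completeness of `Y` makes its image closed in `Y**`, so compact sets pull back to compact sets.
  have hemb := (toBidual Y).isometry.isClosedEmbedding
  refine (isCompactOperator_iff_image_closedBall_subset_compact (T : C(H, ℝ) →ₗ[ℝ] Y)
    one_pos).mpr ⟨_, hemb.isCompact_preimage hKs, ?_⟩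
  rintro _ ⟨f, hf, rfl⟩
  exact (h.2 f).mem_sub hKconv hK.isClosed hKs.isClosed hmK (mem_closedBall_zero_iff.mp hf)

/-- The limit of finite-rank operators is compact into `Y**`; the closed embedding brings
compactness back to `Y`. -/
theorem isCompactOperator_of_tendsto_condOperator [CompleteSpace Y] {μ : Measure H}
    [IsFiniteMeasure μ]
    (h : Tendsto (fun π : Partition H =>
      ‖condOperator μ m π - (toBidual Y).toContinuousLinearMap.comp T‖) atBot (𝓝 0)) :
    IsCompactOperator T := by
  classical
  have h1 : IsCompactOperator ((toBidual Y).toContinuousLinearMap.comp T) :=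
    isCompactOperator_of_tendsto (tendsto_iff_norm_sub_tendsto_zero.mpr h)
      (Eventually.of_forall fun π => isCompactOperator_condOperator m μ π)
  obtain ⟨K, hK, hKT⟩ := h1
  exact ⟨_, (toBidual Y).isometry.isClosedEmbedding.isCompact_preimage hK, hKT⟩

theorem tendsto_condOperator_of_tendsto_semivariation {μ : Measure H} [IsFiniteMeasure μ]
    (hT : ∀ f : C(H, ℝ), HasIntegral m f (toBidual Y (T f)))
    (h : Tendsto (fun π : Partition H => semivariation (fun B => condMeasure μ m π B - m B) ⊤)
      atBot (𝓝 0)) :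
    Tendsto (fun π : Partition H =>
      ‖condOperator μ m π - (toBidual Y).toContinuousLinearMap.comp T‖) atBot (𝓝 0) := by
  rw [Metric.tendsto_nhds]
  intro ε hε
  have hT' : ∀ f : C(H, ℝ),
      HasIntegral m f ((toBidual Y).toContinuousLinearMap.comp T f) := fun f => hT f
  filter_upwards [ENNReal.tendsto_nhds_zero.mp h (ENNReal.ofReal (ε / 3))
    (ENNReal.ofReal_pos.mpr (by positivity))] with π hπ
  have h1 : ‖condOperator μ m π - (toBidual Y).toContinuousLinearMap.comp T‖ ≤ 2 * (ε / 3) := by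
    refine norm_condOperator_sub_le m μ π hT' fun A hA => ?_
    have := (enorm_le_semivariation (condSub μ m π) hA).trans hπ
    rwa [condSub_apply, ← ofReal_norm, ENNReal.ofReal_le_ofReal_iff (by positivity)] at this
  have h0 : 0 ≤ ‖condOperator μ m π - (toBidual Y).toContinuousLinearMap.comp T‖ :=
    ContinuousLinearMap.opNorm_nonneg _
  rw [dist_zero_right, Real.norm_of_nonneg h0]
  linarith

end representation

end VecMeas

theorem theorem2 {H : Type*} [TopologicalSpace H] [CompactSpace H] [T2Space H]
    [MeasurableSpace H] [BorelSpace H]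
    {Y : Type*} [NormedAddCommGroup Y] [NormedSpace ℝ Y] [CompleteSpace Y]
    (T : C(H, ℝ) →L[ℝ] Y)
    (m : VecMeas.FinAddMeasure H (VecMeas.Bidual Y))
    (hmT : VecMeas.Represents m T)
    (μ : Measure H) [IsFiniteMeasure μ]
    (hmμ : VecMeas.AbsCont m μ) :
    List.TFAE
      [Tendsto (fun π : VecMeas.Partition H =>
          VecMeas.semivariation (fun B => VecMeas.condMeasure μ m π B - m B) ⊤) atBot (𝓝 0),
        VecMeas.HasRelCompactRange m,
        IsCompactOperator T] ∧
    (μ.Regular →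
      List.TFAE
        [Tendsto (fun π : VecMeas.Partition H =>
            VecMeas.semivariation (fun B => VecMeas.condMeasure μ m π B - m B) ⊤) atBot (𝓝 0),
          VecMeas.HasRelCompactRange m,
          IsCompactOperator T,
          Tendsto (fun π : VecMeas.Partition H =>
            ‖VecMeas.condOperator μ m π - (VecMeas.toBidual Y).toContinuousLinearMap.comp T‖)
            atBot (𝓝 0)]) := by
  have h12 := VecMeas.hasRelCompactRange_of_tendsto_semivariation (m := m) (μ := μ)
  have h21 := VecMeas.tendsto_semivariation_of_hasRelCompactRange hmμ
  have h23 := VecMeas.isCompactOperator_of_hasRelCompactRange hmT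
  have h32 := VecMeas.hasRelCompactRange_of_isCompactOperator hmT
  have h14 := VecMeas.tendsto_condOperator_of_tendsto_semivariation (μ := μ) hmT.2
  have h43 := VecMeas.isCompactOperator_of_tendsto_condOperator (T := T) (m := m) (μ := μ)
  refine ⟨?_, fun _ => ?_⟩
  · tfae_have 1 → 2 := h12
    tfae_have 2 → 1 := h21
    tfae_have 2 → 3 := h23
    tfae_have 3 → 2 := h32
    tfae_finish
  · tfae_have 1 → 2 := h12
    tfae_have 2 → 1 := h21
    tfae_have 2 → 3 := h23
    tfae_have 3 → 2 := h32
    tfae_have 1 → 4 := h14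
    tfae_have 4 → 3 := h43
    tfae_finish
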